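/- Let $K$ be a field of characteristic $0$ with a ring endomorphism $\sigma$, and let $K\{Y\}=K[y_j^{(m)} : 1\le j\le n,\ m\ge 0]$ be the ring of difference polynomials, where $\sigma$ is extended by $\sigma(y_j^{(m)})=y_j^{(m+1)}$. A prime ideal $\mathfrak q$ of $K\{Y\}$ is called $\sigma$-prime if $\sigma(a)\in\mathfrak q\iff a\in\mathfrak q$. Let $F=(f_1,\dots,f_r)$ be a system in $K\{Y\}$ with maximal order $e\ge 1$, let $[F]$ be the $\sigma$-ideal generated by $F$, and let $\mathfrak p$ be minimal among the $\sigma$-prime ideals containing $[F]$. Put $f_l^{(j)}=\sigma^j(f_l)$ and write $\kappa=\mathrm{Frac}(K\{Y\}/\mathfrak p)$. For $m\in\mathbb N$ let $A_m=K[y_j^{(q)}: 1\le j\le n,\ q\le m]$, let $B_m$ be the localization of $A_m$ at $A_m\cap\mathfrak p$, and let $\Delta_m$ be the ideal of $B_{m-1+e}$ generated by all $f_l^{(j)}$ with $1\le l\le r$, $0\le j<m$ (so $\Delta_0=(0)$). Assume that $F$ is quasi-prime at $\mathfrak p$: every $\Delta_m$, $m\in\mathbb N$, is a prime ideal of $B_{m-1+e}$,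 and the $\sigma$-ideal generated by $F$ in $K\{Y\}_{\mathfrak p}$ is reflexive. Write $\kappa(\Delta_m)=\mathrm{Frac}(B_{m-1+e}/\Delta_m)$ and $\psi(m)=\mathrm{trdeg}_K\,\kappa(\Delta_m)$. For $k\in\mathbb N$ and $i\ge e-1$ let $J_{k,i}$ be the $kr\times kn$ Jacobian matrix of $F^{(i-e+1)},\dots,F^{(i-e+k)}$ with respect to the variables $Y^{(i+1)},\dots,Y^{(i+k)}$, and let $\mu_{k,i}=\dim_\kappa\ker(J_{k,i}^{\tau})=kr-\mathrm{rank}_\kappa(J_{k,i})$, where $\tau$ denotes the transpose. Assume that for all $k\in\mathbb N$ and $i\ge e-1$ the rank of $J_{k,i}$ over $\kappa(\Delta_{i-e+1+k+t})$ is the same for all $t\in\mathbb N$, and is equal to its rank over $\kappa$. The number $\mu_{k,i}$ does not depend on $i\ge e-1$ and is denoted $\mu_k$; the formulas below hold with $\mu_k=\mu_{k,j}$ for every $j\ge e-1$. Then for all $k\in\mathbb N$ and $i\ge e-1$: 1. The field extension $\mathrm{Frac}(B_i/(\Delta_{i-e+1+k}\cap B_i))\hookrightarrow \mathrm{Frac}(B_{i+k}/\Delta_{i-e+1+k})$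 has transcendence degree $k(n-r)+\mu_k$. 2. Suppose that $d\in\mathbb N$ and $s\in\mathbb Z$ are such that $\psi(m)=dm+s$ for all sufficiently large $m$ (that is, $dm+s$ is the $\mathfrak p$-quasi dimension polynomial of $F$), and let $\rho$ be the least number such that $\psi(m)=dm+s$ for all $m\ge\rho$ (the $\mathfrak p$-quasi regularity degree). If $i+k\ge\rho+e-1$, then $$\mathrm{trdeg}_K\,\mathrm{Frac}(B_i/(\Delta_{i-e+1+k}\cap B_i))=d(i+1)+(d+r-n)k+s-ed-\mu_k .$$ -/

import Mathlib

namespace DiffSys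

/-! ### General commutative algebra -/

/-- `Frac (R / I)`, the residue class field of a prime ideal `I` of `R`. -/
abbrev Kappa {R : Type*} [CommRing R] (I : Ideal R) : Type _ := FractionRing (R ⧸ I)

/-- The canonical map `R → Frac (R / I)`. -/
noncomputable def toKappa {R : Type*} [CommRing R] (I : Ideal R) : R →+* Kappa I :=
  (algebraMap (R ⧸ I) (FractionRing (R ⧸ I))).comp (Ideal.Quotient.mk I)

/-- For `φ : R → S` and a prime ideal `I` of `S`, the induced embedding of fields
`Frac (R / φ⁻¹ I) → Frac (S / I)`. -/
noncomputable def kappaMap {R S : Type*} [CommRing R] [CommRing S] (φ : R →+* S)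
    (I : Ideal S) [I.IsPrime] : Kappa (I.comap φ) →+* Kappa I :=
  IsFractionRing.map (j := Ideal.quotientMap I φ le_rfl) Ideal.quotientMap_injective

/-- `L` has finite transcendence degree over `E`, equal to the integer `z`. -/
def HasTrdeg (E L : Type*) [CommRing E] [CommRing L] [Algebra E L] (z : ℤ) : Prop :=
  ∃ t : ℕ, Algebra.trdeg E L = t ∧ (t : ℤ) = z

/-- The extension `φ : E → L` has finite transcendence degree, equal to the integer `z`. -/
def HasTrdegHom {E L : Type*} [CommRing E] [CommRing L] (φ : E →+* L) (z : ℤ) : Prop :=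
  letI : Algebra E L := φ.toAlgebra
  HasTrdeg E L z

/-! ### Difference rings `(R, τ)` -/

/-- `I` is a difference ideal of `(R, τ)`. -/
def IsDiffIdeal {R : Type*} [CommRing R] (τ : R →+* R) (I : Ideal R) : Prop :=
  ∀ a ∈ I, τ a ∈ I

/-- The reflexivity condition `τ a ∈ I → a ∈ I`. -/
def IsReflexive {R : Type*} [CommRing R] (τ : R →+* R) (I : Ideal R) : Prop :=
  ∀ a, τ a ∈ I → a ∈ I

/-- A difference prime ideal: a reflexive difference ideal that is prime. -/
structure IsDiffPrime {R : Type*} [CommRing R] (τ : R →+* R) (I : Ideal R) : Prop where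
  isPrime : I.IsPrime
  isDiffIdeal : IsDiffIdeal τ I
  isReflexive : IsReflexive τ I

/-- `[S]`, the difference ideal generated by `S`. -/
def diffSpan {R : Type*} [CommRing R] (τ : R →+* R) (S : Set R) : Ideal R :=
  sInf {I | IsDiffIdeal τ I ∧ S ⊆ I}

/-- `I` is minimal among the difference prime ideals containing `[S]`. -/
def IsMinimalDiffPrime {R : Type*} [CommRing R] (τ : R →+* R) (S : Set R) (I : Ideal R) : Prop :=
  Minimal (fun J : Ideal R => IsDiffPrime τ J ∧ diffSpan τ S ≤ J) I

theorem IsDiffPrime.eq_comap {R : Type*} [CommRing R] {τ : R →+* R} {I : Ideal R}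
    (h : IsDiffPrime τ I) : I = I.comap τ :=
  le_antisymm (fun a ha => h.isDiffIdeal a ha) (fun a ha => h.isReflexive a ha)

/-- The extension of `τ` to the localization of `R` at a difference prime ideal. -/
noncomputable def localShift {R : Type*} [CommRing R] {τ : R →+* R} {I : Ideal R} [I.IsPrime]
    (h : IsDiffPrime τ I) : Localization.AtPrime I →+* Localization.AtPrime I :=
  Localization.localRingHom I I τ h.eq_comap

/-! ### Difference polynomials

The variable `(j, m)` stands for the `m`-th transform of the `j`-th difference indeterminate. -/

/-- The ring of difference polynomials in `n` difference indeterminates over `K`. -/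
abbrev DPoly (K : Type*) [Field K] (n : ℕ) : Type _ := MvPolynomial (Fin n × ℕ) K

section

variable {K : Type*} [Field K] {n r : ℕ}

/-- The difference operator: it acts as `σ` on `K` and raises the order of each variable by one. -/
noncomputable def shift (σ : K →+* K) : DPoly K n →+* DPoly K n :=
  MvPolynomial.eval₂Hom (MvPolynomial.C.comp σ) fun v => MvPolynomial.X (v.1, v.2 + 1)

/-- The order of a difference polynomial. -/
noncomputable def order (g : DPoly K n) : ℕ := g.vars.sup Prod.snd

/-- `e`, the maximal order of the polynomials of the system. -/
noncomputable def maxOrder (f : Fin r → DPoly K n) : ℕ := Finset.univ.sup fun l => order (f l)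

/-- `A_N`, the polynomial ring in the variables of order at most `N`. -/
abbrev A (K : Type*) [Field K] (n N : ℕ) : Type _ :=
  MvPolynomial {v : Fin n × ℕ // v.2 ≤ N} K

/-- The inclusion of `A_N` into the ring of difference polynomials. -/
noncomputable def valA (K : Type*) [Field K] (n N : ℕ) : A K n N →ₐ[K] DPoly K n :=
  MvPolynomial.rename Subtype.val

/-- The inclusion `A_M → A_N` for `M ≤ N`. -/
noncomputable def inclA (K : Type*) [Field K] (n : ℕ) {M N : ℕ} (h : M ≤ N) :
    A K n M →ₐ[K] A K n N :=
  MvPolynomial.rename fun v => ⟨v.1, v.2.trans h⟩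

theorem valA_inclA {M N : ℕ} (h : M ≤ N) (a : A K n M) :
    valA K n N (inclA K n h a) = valA K n M a := by
  simp only [valA, inclA, MvPolynomial.rename_rename]
  rfl

/-- `A_N ∩ p`. -/
noncomputable def pA (p : Ideal (DPoly K n)) (N : ℕ) : Ideal (A K n N) :=
  p.comap (valA K n N)

instance (p : Ideal (DPoly K n)) [hp : p.IsPrime] (N : ℕ) : (pA p N).IsPrime :=
  Ideal.IsPrime.comap (valA K n N)

theorem pA_eq_comap (p : Ideal (DPoly K n)) {M N : ℕ} (h : M ≤ N) :
    pA p M = (pA p N).comap (inclA K n h).toRingHom := by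
  ext a
  change valA K n M a ∈ p ↔ valA K n N (inclA K n h a) ∈ p
  rw [valA_inclA]

/-- `B_N`, the localization of `A_N` at `A_N ∩ p`. -/
abbrev B (p : Ideal (DPoly K n)) [p.IsPrime] (N : ℕ) : Type _ := Localization.AtPrime (pA p N)

/-- The canonical map `B_M → B_N` for `M ≤ N`. -/
noncomputable def mapB (p : Ideal (DPoly K n)) [p.IsPrime] {M N : ℕ} (h : M ≤ N) :
    B p M →+* B p N :=
  Localization.localRingHom (pA p M) (pA p N) (inclA K n h).toRingHom (pA_eq_comap p h)

/-- The ideal `Δ_m` generated by all transforms `f_l^(j)` with `j < m`, taken in the ring `B_N`.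
The ring in which `Δ_m` lives is `B_N` with `N = m - 1 + e`, which contains all of them. -/
noncomputable def Delta (σ : K →+* K) (f : Fin r → DPoly K n) (p : Ideal (DPoly K n)) [p.IsPrime]
    (m N : ℕ) : Ideal (B p N) :=
  Ideal.span {b | ∃ a : A K n N, (∃ l, ∃ j < m, valA K n N a = (shift σ)^[j] (f l)) ∧
    b = algebraMap (A K n N) (B p N) a}

/-- The system `f` is quasi-prime at `p`. -/
structure IsQuasiPrime (σ : K →+* K) (f : Fin r → DPoly K n) (p : Ideal (DPoly K n)) [p.IsPrime]
    (hp : IsDiffPrime (shift σ) p) : Prop where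
  isPrime_Delta : ∀ m : ℕ, (Delta σ f p m (m + maxOrder f - 1)).IsPrime
  isReflexive : IsReflexive (localShift hp)
    (diffSpan (localShift hp)
      (Set.range fun l => algebraMap (DPoly K n) (Localization.AtPrime p) (f l)))

theorem IsQuasiPrime.isPrime {σ : K →+* K} {f : Fin r → DPoly K n} {p : Ideal (DPoly K n)}
    [p.IsPrime] {hp : IsDiffPrime (shift σ) p} (h : IsQuasiPrime σ f p hp) {m N : ℕ}
    (hN : m + maxOrder f = N + 1) : (Delta σ f p m N).IsPrime := by
  have h1 := h.isPrime_Delta m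
  have h2 : m + maxOrder f - 1 = N := by omega
  rwa [h2] at h1

/-- `ψ(m) = trdeg_K κ(Δ_m)` is the integer `z`. -/
def HasPsi (σ : K →+* K) (f : Fin r → DPoly K n) (p : Ideal (DPoly K n)) [p.IsPrime]
    (m : ℕ) (z : ℤ) : Prop :=
  HasTrdeg K (Kappa (Delta σ f p m (m + maxOrder f - 1))) z

/-- The quasi dimension polynomial is `d m + s`: it agrees with `ψ(m)` for all large `m`. -/
def IsQuasiDimPoly (σ : K →+* K) (f : Fin r → DPoly K n) (p : Ideal (DPoly K n)) [p.IsPrime]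
    (d : ℕ) (s : ℤ) : Prop :=
  ∃ m₀ : ℕ, ∀ m ≥ m₀, HasPsi σ f p m (d * m + s)

/-- `ρ` is the quasi regularity degree with respect to the polynomial `d m + s`: the least number
from which on `ψ(m) = d m + s`. -/
def IsQuasiRegularityDegree (σ : K →+* K) (f : Fin r → DPoly K n) (p : Ideal (DPoly K n))
    [p.IsPrime] (d : ℕ) (s : ℤ) (ρ : ℕ) : Prop :=
  IsLeast {m₀ : ℕ | ∀ m ≥ m₀, HasPsi σ f p m (d * m + s)} ρ

/-- The pseudo-Jacobian matrix `J_{k,i}` of `F^(i-e+1), …, F^(i-e+k)` with respect to the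
variables of orders `i+1, …, i+k` (for `i ≥ e - 1`). -/
noncomputable def pseudoJacobian (σ : K →+* K) (f : Fin r → DPoly K n) (k i : ℕ) :
    Matrix (Fin k × Fin r) (Fin k × Fin n) (DPoly K n) :=
  Matrix.of fun a b =>
    MvPolynomial.pderiv (b.2, i + 1 + (b.1 : ℕ))
      ((shift σ)^[i + 1 - maxOrder f + (a.1 : ℕ)] (f a.2))

theorem maxOrder_mem (f : Fin r → DPoly K n) (l : Fin r) :
    f l ∈ (valA K n (maxOrder f)).range := by
  have h : ((f l).vars : Set (Fin n × ℕ)) ⊆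
      Set.range (Subtype.val : {v : Fin n × ℕ // v.2 ≤ maxOrder f} → Fin n × ℕ) := by
    intro v hv
    have h1 : v.2 ≤ order (f l) := Finset.le_sup (f := Prod.snd) (Finset.mem_coe.1 hv)
    have h2 : order (f l) ≤ maxOrder f :=
      Finset.le_sup (f := fun l => order (f l)) (Finset.mem_univ l)
    exact ⟨⟨v, h1.trans h2⟩, rfl⟩
  obtain ⟨q, hq⟩ := MvPolynomial.exists_rename_eq_of_vars_subset_range (f l) Subtype.val
    Subtype.val_injective h
  exact ⟨q, hq⟩

theorem shift_mem (σ : K →+* K) {N : ℕ} {g : DPoly K n} (hg : g ∈ (valA K n N).range) :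
    shift σ g ∈ (valA K n (N + 1)).range := by
  obtain ⟨q, rfl⟩ := hg
  change shift σ (valA K n N q) ∈ (valA K n (N + 1)).range
  induction q using MvPolynomial.induction_on with
  | C c =>
    refine ⟨MvPolynomial.C (σ c), ?_⟩
    simp [valA, shift]
  | add x y hx hy => rw [map_add, map_add]; exact add_mem hx hy
  | mul_X x v hx =>
    rw [map_mul, map_mul]
    refine mul_mem hx ⟨MvPolynomial.X ⟨(v.1.1, v.1.2 + 1), Nat.succ_le_succ v.2⟩, ?_⟩
    simp [valA, shift]

theorem iterate_shift_mem (σ : K →+* K) {N : ℕ} {g : DPoly K n} (hg : g ∈ (valA K n N).range)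
    (j : ℕ) : (shift σ)^[j] g ∈ (valA K n (N + j)).range := by
  induction j with
  | zero => exact hg
  | succ j ih => rw [Function.iterate_succ_apply']; exact shift_mem σ ih

theorem pderiv_mem {N : ℕ} {g : DPoly K n} (hg : g ∈ (valA K n N).range) (v : Fin n × ℕ) :
    MvPolynomial.pderiv v g ∈ (valA K n N).range := by
  classical
  obtain ⟨q, rfl⟩ := hg
  change MvPolynomial.pderiv v (valA K n N q) ∈ (valA K n N).range
  induction q using MvPolynomial.induction_on with
  | C c => simp [valA]
  | add x y hx hy => rw [map_add, map_add]; exact add_mem hx hy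
  | mul_X x w hx =>
    rw [map_mul, Derivation.leibniz, smul_eq_mul, smul_eq_mul]
    refine add_mem (mul_mem ⟨x, rfl⟩ ?_) (mul_mem ⟨MvPolynomial.X w, rfl⟩ hx)
    simp only [valA, MvPolynomial.rename_X, MvPolynomial.pderiv_X]
    by_cases h : w.1 = v
    · rw [h, Pi.single_eq_same]; exact one_mem _
    · rw [Pi.single_eq_of_ne h]; exact zero_mem _

theorem mem_range_mono {M N : ℕ} (h : M ≤ N) {g : DPoly K n} (hg : g ∈ (valA K n M).range) :
    g ∈ (valA K n N).range := by
  obtain ⟨q, rfl⟩ := hg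
  exact ⟨inclA K n h q, valA_inclA h q⟩

theorem pseudoJacobian_mem (σ : K →+* K) (f : Fin r → DPoly K n) {k i N : ℕ}
    (hi : maxOrder f ≤ i + 1) (hN : i + k ≤ N) (a : Fin k × Fin r) (b : Fin k × Fin n) :
    ∃ q : A K n N, valA K n N q = pseudoJacobian σ f k i a b := by
  have h : pseudoJacobian σ f k i a b ∈ (valA K n N).range := by
    refine mem_range_mono ?_ (pderiv_mem (iterate_shift_mem σ (maxOrder_mem f a.2) _) _)
    have := a.1.isLt
    omega
  exact h

/-- The matrix `J_{k,i}` with its entries regarded as elements of `A_N`, where `N ≥ i + k`. -/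
noncomputable def pseudoJacobianA (σ : K →+* K) (f : Fin r → DPoly K n) {k i N : ℕ}
    (hi : maxOrder f ≤ i + 1) (hN : i + k ≤ N) :
    Matrix (Fin k × Fin r) (Fin k × Fin n) (A K n N) :=
  Matrix.of fun a b => (pseudoJacobian_mem σ f hi hN a b).choose

/-- The inclusion of `A_N` takes `pseudoJacobianA` to `pseudoJacobian`. -/
theorem valA_pseudoJacobianA (σ : K →+* K) (f : Fin r → DPoly K n) {k i N : ℕ}
    (hi : maxOrder f ≤ i + 1) (hN : i + k ≤ N) :
    (pseudoJacobianA σ f hi hN).map (valA K n N) = pseudoJacobian σ f k i := by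
  ext1 a b
  exact (pseudoJacobian_mem σ f hi hN a b).choose_spec

/-- The matrix `J_{k,i}` over `κ`, the residue class field of `p`. -/
noncomputable def pseudoJacobianKappa (σ : K →+* K) (f : Fin r → DPoly K n)
    (p : Ideal (DPoly K n)) (k i : ℕ) : Matrix (Fin k × Fin r) (Fin k × Fin n) (Kappa p) :=
  (pseudoJacobian σ f k i).map (toKappa p)

/-- `μ_{k,i}`, the dimension over `κ` of the kernel of the transpose of `J_{k,i}`. -/
noncomputable def mu (σ : K →+* K) (f : Fin r → DPoly K n) (p : Ideal (DPoly K n))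
    (k i : ℕ) : ℕ :=
  Module.finrank (Kappa p)
    (LinearMap.ker (Matrix.mulVecLin (pseudoJacobianKappa σ f p k i).transpose))

/-- The matrix `J_{k,i}` over `Frac (B_N / Δ_m)`, where `N ≥ i + k`. -/
noncomputable def pseudoJacobianDelta (σ : K →+* K) (f : Fin r → DPoly K n)
    (p : Ideal (DPoly K n)) [p.IsPrime] {k i N : ℕ} (m : ℕ)
    (hi : maxOrder f ≤ i + 1) (hN : i + k ≤ N) :
    Matrix (Fin k × Fin r) (Fin k × Fin n) (Kappa (Delta σ f p m N)) :=
  (pseudoJacobianA σ f hi hN).map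
    ((toKappa (Delta σ f p m N)).comp (algebraMap (A K n N) (B p N)))

/-- The rank hypothesis on the system: for all `k` and all `i ≥ e - 1`, the rank of `J_{k,i}` over
`κ(Δ_{i-e+1+k+s})` is the same for all `s`, and is the same as its rank over `κ`. The residue
class field of `Δ_{i-e+1+k+s}` is formed in `B_{i+k+s}`. -/
def RankCondition (σ : K →+* K) (f : Fin r → DPoly K n) (p : Ideal (DPoly K n))
    [p.IsPrime] : Prop :=
  ∀ (k i : ℕ) (hi : maxOrder f ≤ i + 1) (s : ℕ),
    (pseudoJacobianDelta σ f p (N := i + k + s) (i + 1 - maxOrder f + k + s) hi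
      (Nat.le_add_right (i + k) s)).rank = (pseudoJacobianKappa σ f p k i).rank

end

end DiffSys

namespace DiffSys

/-! Write L = κ(Δ_{i-e+1+k}) and let E be its subfield coming from B_i. Over E, the field L is
generated by the kn variables of orders i+1, …, i+k. In characteristic zero trdeg(L/E) = dim_L
Der_E(L, L), and an E-derivation of L is determined by its values on these variables. A vector of
values extends to a derivation exactly when it is annihilated by the differentials of the generators
of Δ (`hasTrdeg_of_jacobian`). The transforms f_l^(j) with j < i-e+1 have order at most i and impose
no condition; the others give the rows of J_{k,i}. Hence trdeg(L/E) = kn - rank J_{k,i}, the rank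
being taken over L (`hasTrdegHom_kappaMap`).

The rank condition moves this rank to κ, where it equals kr - μ_{k,i}. It is independent of i
because σ induces an embedding of κ into itself carrying J_{k,i} to J_{k,i+1}. This gives k(n-r) +
μ_k. The second formula follows by subtracting it from ψ(i-e+1+k) in the tower K ⊆ E ⊆ L. -/

/-! ### Transcendence degree, differentials and derivations in characteristic zero -/

open KaehlerDifferential in
/-- In characteristic zero, the module of differentials of a field extension has dimension the
transcendence degree. -/
theorem rank_kaehlerDifferential_eq_trdeg (E L : Type*) [Field E] [Field L] [Algebra E L]
    [CharZero E] : Module.rank L (Ω[L⁄E]) = Algebra.trdeg E L := by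
  obtain ⟨s, hs⟩ := exists_isTranscendenceBasis E L
  rw [← hs.cardinalMk_eq_trdeg]
  let S := MvPolynomial s E
  let : Algebra S L := (MvPolynomial.aeval (R := E) ((↑) : s → L)).toAlgebra
  have : IsScalarTower E S L := .of_algebraMap_eq fun x => by
    simp [S, RingHom.algebraMap_toAlgebra]
  have hinj : Function.Injective (algebraMap S L) := hs.1
  have : FaithfulSMul S L := (faithfulSMul_iff_algebraMap_injective _ _).2 hinj
  let F := FractionRing S
  let : Algebra F L := FractionRing.liftAlgebra S L
  have : IsScalarTower S F L := inferInstance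
  have : CharZero S := charZero_of_injective_algebraMap (algebraMap E S).injective
  have : CharZero F := charZero_of_injective_algebraMap (IsFractionRing.injective S F)
  have : Algebra.IsAlgebraic F L := by
    have := hs.isAlgebraic
    have h2 : Algebra.IsAlgebraic S L :=
      Algebra.IsAlgebraic.of_ringHom_of_comp_eq (R := S) (A := L)
        (S := Algebra.adjoin E (Set.range ((↑) : s → L))) (B := L)
        hs.1.aevalEquiv.toRingEquiv.toRingHom (RingHom.id L) hs.1.aevalEquiv.surjective
        Function.injective_id (by ext x <;> simp [S, RingHom.algebraMap_toAlgebra])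
    exact (IsFractionRing.comap_isAlgebraic_iff (A := S) (K := F)).1 h2
  -- L is algebraic, hence separable, over F, and F is a localization of S. So L is formally étale
  -- over the polynomial ring S, and the differentials of its variables become a basis of Ω[L⁄E].
  have : Algebra.FormallyEtale F L := Algebra.FormallyEtale.of_isSeparable F L
  have : Algebra.FormallyEtale S F := Algebra.FormallyEtale.of_isLocalization (nonZeroDivisors S)
  have : Algebra.FormallyEtale S L := Algebra.FormallyEtale.comp S F L
  exact ((((mvPolynomialBasis E s).baseChange L).map
    (tensorKaehlerEquivOfFormallyEtale E S L)).mk_eq_rank'').symm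

/-- Derivations into L are the dual of Ω[L⁄E]. A vector space with finite-dimensional dual is itself
finite-dimensional, so both have the same dimension. -/
theorem trdeg_eq_finrank_derivation (E L : Type*) [Field E] [Field L] [Algebra E L]
    [CharZero E] [Module.Finite L (Derivation E L L)] :
    Algebra.trdeg E L = Module.finrank L (Derivation E L L) := by
  let e := KaehlerDifferential.linearMapEquivDerivation E L (M := L)
  have : Module.Finite L (Module.Dual L (Ω[L⁄E])) := Module.Finite.equiv e.symm
  have : Module.Finite L (Ω[L⁄E]) := (Module.finite_dual_iff L).1 this
  rw [← rank_kaehlerDifferential_eq_trdeg, ← Module.finrank_eq_rank, ← e.finrank_eq]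
  exact congrArg _ (Subspace.dual_finrank_eq).symm

/-- A derivation along a ring homomorphism `φ : A → L` such that every element of `L` is a
fraction of elements of `φ A` extends to `L` if it vanishes on the kernel of `φ`. -/
theorem exists_derivation_extension {A E L : Type*} [CommRing A] [Field E] [Field L] [Algebra E L]
    (φ : A →+* L) (D : A →+ L) (hD : ∀ a b, D (a * b) = φ a * D b + φ b * D a)
    (hfrac : ∀ x : L, ∃ a b : A, φ b ≠ 0 ∧ x * φ b = φ a)
    (hker : ∀ a, φ a = 0 → D a = 0)
    (hE : ∀ x : E, ∃ a b : A, φ b ≠ 0 ∧ algebraMap E L x * φ b = φ a ∧ D a = 0 ∧ D b = 0) :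
    ∃ D' : Derivation E L L, ∀ a, D' (φ a) = D a := by
  have hD1 : D 1 = 0 := by simpa using hD 1 1
  choose u v hv huv using hfrac
  -- The quotient rule applied to a chosen representation x = φ(u) / φ(v).
  let g : L → L := fun x => (D (u x) - x * D (v x)) / φ (v x)
  have hg0 : ∀ x, g x * φ (v x) + x * D (v x) = D (u x) := fun x => by
    simp only [g]
    rw [div_mul_cancel₀ _ (hv x), sub_add_cancel]
  clear_value g
  -- Independence of the representation: a v - u b lies in the kernel of φ, so D kills it.
  have hg : ∀ (x : L) (a b : A), x * φ b = φ a → g x * φ b + x * D b = D a := by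
    intro x a b hab
    have h1 : φ (a * v x - u x * b) = 0 := by
      rw [map_sub, map_mul, map_mul, ← hab, ← huv]; ring
    have h2 := hker _ h1
    simp only [map_sub, hD, ← hab, ← huv] at h2
    have h3 := hg0 x
    apply mul_right_cancel₀ (hv x)
    linear_combination φ b * h3 - h2
  have hgeq : ∀ (x y : L) (a b : A), φ b ≠ 0 → x * φ b = φ a → y * φ b + x * D b = D a →
      g x = y := by
    intro x y a b hb hab h
    apply mul_right_cancel₀ hb
    linear_combination hg x a b hab - h
  have hadd : ∀ x y, g (x + y) = g x + g y := by
    intro x y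
    refine hgeq _ _ (u x * v y + u y * v x) (v x * v y) ?_ ?_ ?_
    · rw [map_mul]; exact mul_ne_zero (hv x) (hv y)
    · simp only [map_add, map_mul, ← huv]; ring
    · simp only [map_add, map_mul, hD, ← huv]
      linear_combination φ (v y) * hg0 x + φ (v x) * hg0 y
  have hmul : ∀ x y, g (x * y) = x * g y + y * g x := by
    intro x y
    refine hgeq _ _ (u x * u y) (v x * v y) ?_ ?_ ?_
    · rw [map_mul]; exact mul_ne_zero (hv x) (hv y)
    · simp only [map_mul, ← huv]; ring
    · simp only [map_mul, hD, ← huv]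
      linear_combination (y * φ (v y)) * hg0 x + (x * φ (v x)) * hg0 y
  have hgE : ∀ x : E, g (algebraMap E L x) = 0 := by
    intro x
    obtain ⟨a, b, hb, hab, ha, hb'⟩ := hE x
    refine hgeq _ _ a b hb hab ?_
    rw [ha, hb']; ring
  refine ⟨Derivation.mk' { toFun := g, map_add' := hadd, map_smul' := fun c x => ?_ } hmul, ?_⟩
  · rw [Algebra.smul_def, hmul, hgE, mul_zero, add_zero, RingHom.id_apply, Algebra.smul_def]
  · intro a
    refine hgeq _ _ a 1 ?_ ?_ ?_ <;> simp [hD1]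

/-! ### Matrix rank under field extension -/

theorem card_le_rank_of_linearIndependent_col {k m n ι : Type*} [Field k] [Finite m] [Fintype n]
    [Fintype ι] (M : Matrix m n k) (a : ι → n) (h : LinearIndependent k (M.col ∘ a)) :
    Fintype.card ι ≤ M.rank := by
  rw [Matrix.rank_eq_finrank_span_cols, ← finrank_span_eq_card h]
  exact Submodule.finrank_mono (Submodule.span_mono (Set.range_comp_subset_range _ _))

theorem exists_linearIndependent_col_card_eq_rank {k m n : Type*} [Field k] [Finite m] [Fintype n]
    (M : Matrix m n k) :
    ∃ s : Finset n, LinearIndependent k (fun j : s => M.col j) ∧ s.card = M.rank := by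
  classical
  obtain ⟨ι, a, ha, hspan, hli⟩ := exists_linearIndependent' k M.col
  have : Fintype ι := Fintype.ofInjective a ha
  refine ⟨Finset.univ.map ⟨a, ha⟩, ?_, ?_⟩
  · let e : ι ≃ (Finset.univ.map ⟨a, ha⟩ : Finset n) :=
      Equiv.ofBijective (fun i => ⟨a i, by simp⟩)
        ⟨fun i j h => ha (congrArg Subtype.val h), fun ⟨x, hx⟩ => by
          obtain ⟨i, _, rfl⟩ := Finset.mem_map.1 hx
          exact ⟨i, rfl⟩⟩
    exact (linearIndependent_equiv e).1 hli
  · rw [Finset.card_map, Finset.card_univ, Matrix.rank_eq_finrank_span_cols, ← hspan,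
      finrank_span_eq_card hli]

/-- The rank of a matrix over a field is unchanged by a field extension. -/
theorem rank_map_field {k l : Type*} [Field k] [Field l] (φ : k →+* l) {m n : Type*} [Finite m]
    [Fintype n] (M : Matrix m n k) : (M.map φ).rank = M.rank := by
  let := φ.toAlgebra
  -- Linear independence of columns is both preserved and reflected by a field extension, so maximal
  -- independent sets of columns have the same size on both sides.
  have key : ∀ s : Finset n, LinearIndependent k (fun j : s => M.col j) ↔
      LinearIndependent l (fun j : s => (M.map φ).col j) := fun s =>
    (linearIndependent_algebraMap_comp_iff (S := l)).symm
  obtain ⟨s, hs, hs'⟩ := exists_linearIndependent_col_card_eq_rank M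
  obtain ⟨t, ht, ht'⟩ := exists_linearIndependent_col_card_eq_rank (M.map φ)
  refine le_antisymm ?_ ?_
  · rw [← ht', ← Fintype.card_coe]
    exact card_le_rank_of_linearIndependent_col M (Subtype.val : t → n) ((key t).2 ht)
  · rw [← hs', ← Fintype.card_coe]
    exact card_le_rank_of_linearIndependent_col (M.map φ) (Subtype.val : s → n) ((key s).1 hs)

/-! ### The Jacobian criterion -/

/-- The transcendence degree of the field generated over `E` by the images of finitely many
variables, by the Jacobian criterion. -/
theorem hasTrdeg_of_jacobian {K E L V W ι : Type*} [Field K] [Field E] [CharZero E] [Field L]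
    [Algebra E L] [Fintype W] [Finite ι] (φ : MvPolynomial V K →+* L) (w : W → V)
    (hw : Function.Injective w)
    (hfrac : ∀ x : L, ∃ a b, φ b ≠ 0 ∧ x * φ b = φ a)
    (hC : ∀ c, φ (MvPolynomial.C c) ∈ (algebraMap E L).range)
    (hX : ∀ v, v ∉ Set.range w → φ (MvPolynomial.X v) ∈ (algebraMap E L).range)
    (hE : ∀ x : E, ∃ a b, φ b ≠ 0 ∧ algebraMap E L x * φ b = φ a ∧
      (∀ v, MvPolynomial.pderiv (w v) a = 0) ∧ ∀ v, MvPolynomial.pderiv (w v) b = 0)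
    (G : Set (MvPolynomial V K)) (hG : ∀ g ∈ G, φ g = 0)
    (hker : ∀ a, φ a = 0 → ∃ s, φ s ≠ 0 ∧ s * a ∈ Ideal.span G)
    (M : Matrix ι W L)
    (hM : ∀ u : W → L, M.mulVec u = 0 ↔
      ∀ g ∈ G, ∑ v, φ (MvPolynomial.pderiv (w v) g) * u v = 0) :
    HasTrdeg E L (Fintype.card W - M.rank) := by
  classical
  -- The candidate derivation along φ with value u v at the variable w v, all other variables and
  -- the coefficients being treated as constants.
  let T : (W → L) → MvPolynomial V K →+ L := fun u =>
    { toFun := fun a => ∑ v, φ (MvPolynomial.pderiv (w v) a) * u v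
      map_zero' := by simp
      map_add' := fun a b => by simp [add_mul, Finset.sum_add_distrib] }
  have hT : ∀ u a, T u a = ∑ v, φ (MvPolynomial.pderiv (w v) a) * u v := fun _ _ => rfl
  have hTmul : ∀ u a b, T u (a * b) = φ a * T u b + φ b * T u a := by
    intro u a b
    simp only [hT, Finset.mul_sum, ← Finset.sum_add_distrib]
    refine Finset.sum_congr rfl fun v _ => ?_
    simp only [MvPolynomial.pderiv_mul, map_add, map_mul]
    ring
  have hTX : ∀ u v, T u (MvPolynomial.X (w v)) = u v := by
    intro u v
    rw [hT, Finset.sum_eq_single v]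
    · simp
    · intro b _ hb
      rw [MvPolynomial.pderiv_X_of_ne (fun h => hb (hw h).symm)]
      simp
    · simp
  let ev : Derivation E L L →ₗ[L] (W → L) :=
    { toFun := fun D v => D (φ (MvPolynomial.X (w v)))
      map_add' := fun _ _ => rfl
      map_smul' := fun _ _ => rfl }
  have chain : ∀ (D : Derivation E L L) a, D (φ a) = T (ev D) a := by
    intro D a
    have hrange : ∀ x ∈ (algebraMap E L).range, D x = 0 := by
      rintro _ ⟨x, rfl⟩
      exact D.map_algebraMap x
    induction a using MvPolynomial.induction_on with
    | C c => rw [hrange _ (hC c), hT]; simp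
    | add a b ha hb => rw [map_add, map_add, map_add, ha, hb]
    | mul_X a v ha =>
      rw [map_mul, Derivation.leibniz, hTmul, ha, smul_eq_mul, smul_eq_mul]
      congr 2
      by_cases hv : v ∈ Set.range w
      · obtain ⟨v, rfl⟩ := hv
        exact (hTX (ev D) v).symm
      · rw [hrange _ (hX v hv), hT]
        refine (Finset.sum_eq_zero fun b _ => ?_).symm
        rw [MvPolynomial.pderiv_X_of_ne (fun h => hv ⟨b, h.symm⟩)]
        simp
  have hinj : Function.Injective ev := by
    rw [injective_iff_map_eq_zero]
    intro D hD
    have h0 : ∀ a, D (φ a) = 0 := fun a => by rw [chain, hD, hT]; simp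
    ext x
    obtain ⟨a, b, hb, hab⟩ := hfrac x
    have h1 := congrArg D hab
    rw [Derivation.leibniz, h0, h0, smul_zero, zero_add, smul_eq_mul] at h1
    exact (mul_eq_zero.1 h1).resolve_left hb
  -- The values that occur are exactly the solutions of the linear system: necessity is the chain
  -- rule, sufficiency the extension lemma.
  have hrange : LinearMap.range ev = LinearMap.ker M.mulVecLin := by
    apply le_antisymm
    · rintro _ ⟨D, rfl⟩
      rw [LinearMap.mem_ker, Matrix.mulVecLin_apply, hM]
      intro g hg
      rw [← hT, ← chain, hG g hg, map_zero]
    · intro u hu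
      rw [LinearMap.mem_ker, Matrix.mulVecLin_apply, hM] at hu
      have hspan : ∀ a ∈ Ideal.span G, φ a = 0 ∧ T u a = 0 := by
        intro a ha
        induction ha using Submodule.span_induction with
        | mem g hg => exact ⟨hG g hg, hu g hg⟩
        | zero => simp
        | add a b _ _ ha hb => simp [ha.1, ha.2, hb.1, hb.2]
        | smul c a _ ha => simp [hTmul, ha.1, ha.2]
      -- Since G generates the kernel only up to a denominator s, apply T u to s a. With φ a = 0 the
      -- product rule leaves φ s * T u a = 0.
      have hker' : ∀ a, φ a = 0 → T u a = 0 := by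
        intro a ha
        obtain ⟨s, hs, hsa⟩ := hker a ha
        have h1 := (hspan _ hsa).2
        rw [hTmul, ha, zero_mul, add_zero] at h1
        exact (mul_eq_zero.1 h1).resolve_left hs
      obtain ⟨D, hD⟩ := exists_derivation_extension φ (T u) (hTmul u) hfrac hker' fun x => by
        obtain ⟨a, b, hb, hab, ha', hb'⟩ := hE x
        exact ⟨a, b, hb, hab, by simp [hT, ha'], by simp [hT, hb']⟩
      exact ⟨D, funext fun v => (hD _).trans (hTX u v)⟩
  have : Module.Finite L (Derivation E L L) := Module.Finite.of_injective ev hinj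
  refine ⟨_, trdeg_eq_finrank_derivation E L, ?_⟩
  rw [← LinearMap.finrank_range_of_inj hinj, hrange]
  have h := LinearMap.finrank_range_add_finrank_ker M.mulVecLin
  rw [Module.finrank_fintype_fun_eq_card] at h
  rw [← h, Matrix.rank]
  push_cast
  ring

/-! ### Residue class fields of localizations -/

theorem toKappa_eq_zero {R : Type*} [CommRing R] (I : Ideal R) {b : R} :
    toKappa I b = 0 ↔ b ∈ I := by
  rw [toKappa, RingHom.comp_apply, ← Ideal.Quotient.eq_zero_iff_mem]
  exact (IsFractionRing.injective (R ⧸ I) (FractionRing (R ⧸ I))).eq_iff' (map_zero _)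

theorem kappaMap_toKappa {R S : Type*} [CommRing R] [CommRing S] (φ : R →+* S)
    (I : Ideal S) [I.IsPrime] (b : R) :
    kappaMap φ I (toKappa (I.comap φ) b) = toKappa I (φ b) := by
  rw [toKappa, RingHom.comp_apply, kappaMap, IsFractionRing.map]
  erw [IsLocalization.map_eq]
  rfl

/-- Every element of the residue class field of a prime ideal of a localization of `A` is a
fraction of images of elements of `A`. -/
theorem exists_mul_toKappa_eq {A B : Type*} [CommRing A] (S : Submonoid A) [CommRing B]
    [Algebra A B] [IsLocalization S B] (I : Ideal B) [I.IsPrime] (x : Kappa I) :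
    ∃ a b : A, toKappa I (algebraMap A B b) ≠ 0 ∧
      x * toKappa I (algebraMap A B b) = toKappa I (algebraMap A B a) := by
  obtain ⟨y, z, hz, rfl⟩ := IsFractionRing.div_surjective (A := B ⧸ I) x
  obtain ⟨y, rfl⟩ := Ideal.Quotient.mk_surjective y
  obtain ⟨z, rfl⟩ := Ideal.Quotient.mk_surjective z
  have hz0 : toKappa I z ≠ 0 := by
    rw [Ne, toKappa_eq_zero, ← Ideal.Quotient.eq_zero_iff_mem]
    exact nonZeroDivisors.ne_zero hz
  obtain ⟨⟨a, s⟩, hy⟩ := IsLocalization.surj S y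
  obtain ⟨⟨b, t⟩, hb⟩ := IsLocalization.surj S z
  have hunit : ∀ s : S, toKappa I (algebraMap A B s) ≠ 0 := fun s =>
    (((IsLocalization.map_units B s).map (toKappa I))).ne_zero
  have hy' := congrArg (toKappa I) hy
  have hb' := congrArg (toKappa I) hb
  rw [map_mul] at hy' hb'
  change toKappa I y * toKappa I (algebraMap A B s) = toKappa I (algebraMap A B a) at hy'
  change toKappa I z * toKappa I (algebraMap A B t) = toKappa I (algebraMap A B b) at hb'
  -- With y = a / s and z = b / t, the quotient y / z is a t / (b s).
  refine ⟨a * t, b * s, ?_, ?_⟩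
  · rw [map_mul, map_mul, ← hb']
    exact mul_ne_zero (mul_ne_zero hz0 (hunit t)) (hunit s)
  · change toKappa I y / toKappa I z * _ = _
    rw [map_mul, map_mul, map_mul, map_mul, ← hb', ← hy']
    field_simp

/-! ### Invariance of the rank of J_{k,i} over κ under the shift -/

section

variable {K : Type*} [Field K] {n r : ℕ}

theorem pderiv_shift (σ : K →+* K) (j : Fin n) (m : ℕ) (g : DPoly K n) :
    MvPolynomial.pderiv (j, m + 1) (shift σ g) = shift σ (MvPolynomial.pderiv (j, m) g) := by
  classical
  induction g using MvPolynomial.induction_on with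
  | C c => simp [shift]
  | add a b ha hb => simp only [map_add, ha, hb]
  | mul_X a v ha =>
    have hX : ∀ v : Fin n × ℕ, shift σ (MvPolynomial.X v) = MvPolynomial.X (v.1, v.2 + 1) :=
      fun v => by simp [shift]
    have h : MvPolynomial.pderiv (j, m + 1) (shift σ (MvPolynomial.X v)) =
        shift σ (MvPolynomial.pderiv (j, m) (MvPolynomial.X v)) := by
      rw [hX]
      by_cases hv : v = (j, m)
      · subst hv; simp
      · rw [MvPolynomial.pderiv_X_of_ne hv, MvPolynomial.pderiv_X_of_ne, map_zero]
        intro h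
        exact hv (by ext <;> simp_all)
    simp only [map_mul, MvPolynomial.pderiv_mul, map_add, ha, h]

theorem pseudoJacobian_succ (σ : K →+* K) (f : Fin r → DPoly K n) (k : ℕ) {i : ℕ}
    (hi : maxOrder f ≤ i + 1) :
    pseudoJacobian σ f k (i + 1) = (pseudoJacobian σ f k i).map (shift σ) := by
  ext1 a b
  simp only [pseudoJacobian, Matrix.of_apply, Matrix.map_apply]
  rw [← pderiv_shift, ← Function.iterate_succ_apply' (shift σ)]
  congr 3 <;> omega

theorem rank_pseudoJacobianKappa_succ (σ : K →+* K) (f : Fin r → DPoly K n)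
    {p : Ideal (DPoly K n)} [p.IsPrime] (hp : IsDiffPrime (shift σ) p) (k : ℕ) {i : ℕ}
    (hi : maxOrder f ≤ i + 1) :
    (pseudoJacobianKappa σ f p k (i + 1)).rank = (pseudoJacobianKappa σ f p k i).rank := by
  let q : DPoly K n ⧸ p →+* DPoly K n ⧸ p := Ideal.quotientMap p (shift σ) hp.eq_comap.le
  -- Reflexivity of p makes the endomorphism of the quotient injective, so it extends to κ.
  have hq : Function.Injective q := Ideal.quotientMap_injective' hp.eq_comap.ge
  let τ : Kappa p →+* Kappa p := IsFractionRing.map hq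
  have hτ : ∀ a, τ (toKappa p a) = toKappa p (shift σ a) := fun a =>
    (IsLocalization.map_eq _ _).trans rfl
  rw [← rank_map_field τ (pseudoJacobianKappa σ f p k i), pseudoJacobianKappa,
    pseudoJacobian_succ σ f k hi]
  congr 1
  ext1 a b
  simp only [pseudoJacobianKappa, Matrix.map_apply, hτ]

theorem rank_pseudoJacobianKappa_eq (σ : K →+* K) (f : Fin r → DPoly K n)
    {p : Ideal (DPoly K n)} [p.IsPrime] (hp : IsDiffPrime (shift σ) p) (k : ℕ) {i j : ℕ}
    (hi : maxOrder f ≤ i + 1) (hj : maxOrder f ≤ j + 1) :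
    (pseudoJacobianKappa σ f p k i).rank = (pseudoJacobianKappa σ f p k j).rank := by
  have h : ∀ t, (pseudoJacobianKappa σ f p k (maxOrder f - 1 + t)).rank =
      (pseudoJacobianKappa σ f p k (maxOrder f - 1)).rank := by
    intro t
    induction t with
    | zero => rfl
    | succ t ih =>
      rw [← ih, ← add_assoc]
      exact rank_pseudoJacobianKappa_succ σ f hp k (by omega)
  rw [← Nat.add_sub_cancel' (show maxOrder f - 1 ≤ i by omega), h,
    ← Nat.add_sub_cancel' (show maxOrder f - 1 ≤ j by omega), h]

theorem mu_add_rank (σ : K →+* K) (f : Fin r → DPoly K n) (p : Ideal (DPoly K n)) [p.IsPrime]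
    (k i : ℕ) : mu σ f p k i + (pseudoJacobianKappa σ f p k i).rank = k * r := by
  have h := LinearMap.finrank_range_add_finrank_ker
    (Matrix.mulVecLin (pseudoJacobianKappa σ f p k i).transpose)
  rw [Module.finrank_fintype_fun_eq_card, Fintype.card_prod, Fintype.card_fin,
    Fintype.card_fin] at h
  rw [← Matrix.rank_transpose, Matrix.rank, mu, ← h, add_comm]

/-! ### The rings A_N and B_N and the generators of Δ -/

theorem valA_injective (K : Type*) [Field K] (n N : ℕ) : Function.Injective (valA K n N) :=
  MvPolynomial.rename_injective _ Subtype.val_injective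

theorem valA_pderiv {N : ℕ} (v : {v : Fin n × ℕ // v.2 ≤ N}) (a : A K n N) :
    valA K n N (MvPolynomial.pderiv v a) = MvPolynomial.pderiv v.1 (valA K n N a) :=
  (MvPolynomial.pderiv_rename Subtype.val_injective _ _).symm

theorem pderiv_valA_eq_zero {N : ℕ} {v : Fin n × ℕ} (hv : N < v.2) (a : A K n N) :
    MvPolynomial.pderiv v (valA K n N a) = 0 := by
  classical
  refine MvPolynomial.pderiv_eq_zero_of_notMem_vars fun h => ?_
  obtain ⟨w, _, rfl⟩ := Finset.mem_image.1 (MvPolynomial.vars_rename _ _ h)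
  exact absurd w.2 (not_le.2 hv)

theorem pderiv_inclA_eq_zero {M N : ℕ} (h : M ≤ N) (v : {v : Fin n × ℕ // v.2 ≤ N})
    (hv : M < v.1.2) (a : A K n M) : MvPolynomial.pderiv v (inclA K n h a) = 0 :=
  valA_injective K n N <| by rw [valA_pderiv, valA_inclA, pderiv_valA_eq_zero hv, map_zero]

theorem mapB_algebraMap (p : Ideal (DPoly K n)) [p.IsPrime] {M N : ℕ} (h : M ≤ N) (a : A K n M) :
    mapB p h (algebraMap (A K n M) (B p M) a) = algebraMap (A K n N) (B p N) (inclA K n h a) :=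
  Localization.localRingHom_to_map _ _ _ _ _

/-- The transforms `f_l^(j)` with `j < m`, as elements of `A_N`. -/
def transforms (σ : K →+* K) (f : Fin r → DPoly K n) (m N : ℕ) : Set (A K n N) :=
  {a | ∃ l, ∃ j < m, valA K n N a = (shift σ)^[j] (f l)}

theorem Delta_eq_map (σ : K →+* K) (f : Fin r → DPoly K n) (p : Ideal (DPoly K n)) [p.IsPrime]
    (m N : ℕ) :
    Delta σ f p m N = (Ideal.span (transforms σ f m N)).map (algebraMap (A K n N) (B p N)) := by
  rw [Ideal.map_span, Delta]
  congr 1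
  ext b
  exact ⟨fun ⟨a, ha, hb⟩ => ⟨a, ha, hb.symm⟩, fun ⟨a, ha, hb⟩ => ⟨a, ha, hb.symm⟩⟩

/-- The ring homomorphism `A_N → Frac (B_N / I)`. -/
noncomputable def resA (p : Ideal (DPoly K n)) [p.IsPrime] {N : ℕ} (I : Ideal (B p N)) :
    A K n N →+* Kappa I :=
  (toKappa I).comp (algebraMap (A K n N) (B p N))

theorem resA_eq_zero (p : Ideal (DPoly K n)) [p.IsPrime] {N : ℕ} (I : Ideal (B p N))
    (a : A K n N) : resA p I a = 0 ↔ algebraMap (A K n N) (B p N) a ∈ I :=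
  toKappa_eq_zero I

theorem kappaMap_resA (p : Ideal (DPoly K n)) [p.IsPrime] {M N : ℕ} (h : M ≤ N)
    (I : Ideal (B p N)) [I.IsPrime] (a : A K n M) :
    kappaMap (mapB p h) I (resA p (I.comap (mapB p h)) a) = resA p I (inclA K n h a) := by
  rw [resA, RingHom.comp_apply, kappaMap_toKappa, mapB_algebraMap, resA, RingHom.comp_apply]

theorem algebraMap_kappa (p : Ideal (DPoly K n)) [p.IsPrime] {N : ℕ} (I : Ideal (B p N)) (c : K) :
    algebraMap K (Kappa I) c = resA p I (MvPolynomial.C c) :=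
  rfl

/-- The kernel of the pseudo-Jacobian matrix is cut out by the differentials of all transforms
generating `Δ`. -/
theorem mulVec_pseudoJacobianDelta_eq_zero_iff (σ : K →+* K) (f : Fin r → DPoly K n)
    (p : Ideal (DPoly K n)) [p.IsPrime] {k i : ℕ} (hi : maxOrder f ≤ i + 1)
    (w : Fin k × Fin n → {v : Fin n × ℕ // v.2 ≤ i + k})
    (hw : ∀ b, (w b).1 = (b.2, i + 1 + (b.1 : ℕ)))
    [(Delta σ f p (i + 1 - maxOrder f + k) (i + k)).IsPrime]
    (u : Fin k × Fin n → Kappa (Delta σ f p (i + 1 - maxOrder f + k) (i + k))) :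
    (pseudoJacobianDelta σ f p (i + 1 - maxOrder f + k) hi (le_refl (i + k))).mulVec u = 0 ↔
      ∀ g ∈ transforms σ f (i + 1 - maxOrder f + k) (i + k),
        ∑ b, resA p (Delta σ f p (i + 1 - maxOrder f + k) (i + k))
          (MvPolynomial.pderiv (w b) g) * u b = 0 := by
  have hentry : ∀ (a : Fin k × Fin r) (g : A K n (i + k)),
      valA K n (i + k) g = (shift σ)^[i + 1 - maxOrder f + (a.1 : ℕ)] (f a.2) → ∀ b,
      pseudoJacobianDelta σ f p (i + 1 - maxOrder f + k) hi (le_refl (i + k)) a b =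
        resA p (Delta σ f p (i + 1 - maxOrder f + k) (i + k)) (MvPolynomial.pderiv (w b) g) := by
    intro a g hg b
    have h1 := congrFun (congrFun (valA_pseudoJacobianA σ f hi (le_refl (i + k))) a) b
    refine congrArg (resA p _) (valA_injective K n (i + k) ?_)
    rw [valA_pderiv, hw, hg]
    exact h1
  constructor
  · rintro h g ⟨l, j, hj, hg⟩
    -- Such a transform has order at most e + j ≤ i, so its partial derivatives in the variables of
    -- order above i vanish.
    by_cases hji : j < i + 1 - maxOrder f
    · refine Finset.sum_eq_zero fun b _ => ?_
      have h0 : MvPolynomial.pderiv (w b) g = 0 := by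
        apply valA_injective K n (i + k)
        obtain ⟨q, hq⟩ := iterate_shift_mem σ (maxOrder_mem f l) j
        rw [valA_pderiv, hg, ← hq, map_zero]
        refine pderiv_valA_eq_zero ?_ q
        rw [hw]
        change maxOrder f + j < i + 1 + _
        omega
      rw [h0, map_zero, zero_mul]
    · have h1 := congrFun h (⟨j - (i + 1 - maxOrder f), by omega⟩, l)
      rw [Pi.zero_apply, Matrix.mulVec, dotProduct] at h1
      rw [← h1]
      refine Finset.sum_congr rfl fun b _ => ?_
      rw [hentry _ g]
      rw [hg]
      congr 2
      simp only
      omega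
  · intro h
    funext a
    obtain ⟨g, hg⟩ := mem_range_mono (N := i + k) (by have := a.1.isLt; omega)
      (iterate_shift_mem σ (maxOrder_mem f a.2) (i + 1 - maxOrder f + (a.1 : ℕ)))
    replace hg : valA K n (i + k) g = _ := hg
    rw [Pi.zero_apply, Matrix.mulVec, dotProduct,
      ← h g ⟨a.2, _, by have := a.1.isLt; omega, hg⟩]
    exact Finset.sum_congr rfl fun b _ => by rw [hentry a g hg]

/-- The Jacobian criterion with W the variables of orders i+1, …, i+k and G the transforms
generating Δ. The coefficients and the remaining variables already lie in B_i. -/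
theorem hasTrdegHom_kappaMap [CharZero K] (σ : K →+* K) (f : Fin r → DPoly K n)
    (p : Ideal (DPoly K n)) [p.IsPrime] {k i : ℕ} (hi : maxOrder f ≤ i + 1)
    [(Delta σ f p (i + 1 - maxOrder f + k) (i + k)).IsPrime] :
    HasTrdegHom (kappaMap (mapB p (Nat.le_add_right i k))
        (Delta σ f p (i + 1 - maxOrder f + k) (i + k)))
      ((k : ℤ) * n -
        (pseudoJacobianDelta σ f p (i + 1 - maxOrder f + k) hi (le_refl (i + k))).rank) := by
  set Δ := Delta σ f p (i + 1 - maxOrder f + k) (i + k) with hΔ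
  let ι := mapB p (Nat.le_add_right i k)
  let : Algebra (Kappa (Δ.comap ι)) (Kappa Δ) := (kappaMap ι Δ).toAlgebra
  have hιmap : ∀ x, algebraMap (Kappa (Δ.comap ι)) (Kappa Δ) x = kappaMap ι Δ x := fun _ => rfl
  have : CharZero (Kappa (Δ.comap ι)) :=
    charZero_of_injective_algebraMap (algebraMap K (Kappa (Δ.comap ι))).injective
  let w : Fin k × Fin n → {v : Fin n × ℕ // v.2 ≤ i + k} := fun b =>
    ⟨(b.2, i + 1 + (b.1 : ℕ)), by have := b.1.isLt; change i + 1 + (b.1 : ℕ) ≤ i + k; omega⟩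
  have hw : Function.Injective w := by
    rintro ⟨a, b⟩ ⟨a', b'⟩ h
    simp only [w, Subtype.mk.injEq, Prod.mk.injEq] at h
    ext
    · simp; omega
    · simp [h.1]
  have hcard : (k : ℤ) * n = (Fintype.card (Fin k × Fin n) : ℕ) := by simp
  rw [hcard]
  refine hasTrdeg_of_jacobian (resA p Δ) w hw
    (exists_mul_toKappa_eq (pA p (i + k)).primeCompl Δ) ?_ ?_ ?_
    (transforms σ f (i + 1 - maxOrder f + k) (i + k)) ?_ ?_ _
    (mulVec_pseudoJacobianDelta_eq_zero_iff σ f p hi w fun _ => rfl)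
  · intro c
    refine ⟨resA p (Δ.comap ι) (MvPolynomial.C c), ?_⟩
    rw [hιmap, kappaMap_resA]
    simp [inclA]
  · intro v hv
    have hvi : v.1.2 ≤ i := by
      by_contra h
      refine hv ⟨(⟨v.1.2 - (i + 1), ?_⟩, v.1.1), ?_⟩
      · have := v.2; omega
      · refine Subtype.ext (Prod.ext rfl ?_)
        change i + 1 + (v.1.2 - (i + 1)) = v.1.2
        omega
    refine ⟨resA p (Δ.comap ι) (MvPolynomial.X ⟨v.1, hvi⟩), ?_⟩
    rw [hιmap, kappaMap_resA]
    simp [inclA]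
  · intro x
    obtain ⟨a, b, hb, hab⟩ := exists_mul_toKappa_eq (pA p i).primeCompl (Δ.comap ι) x
    change resA p (Δ.comap ι) b ≠ 0 at hb
    change x * resA p (Δ.comap ι) b = resA p (Δ.comap ι) a at hab
    -- Elements of the smaller field are fractions of polynomials of order at most i, which are
    -- constant in the variables w v.
    have hlt : ∀ v, i < (w v).1.2 := fun v => by
      change i < i + 1 + (v.1 : ℕ)
      omega
    refine ⟨inclA K n (Nat.le_add_right i k) a, inclA K n (Nat.le_add_right i k) b, ?_, ?_,
      fun v => pderiv_inclA_eq_zero _ _ (hlt v) _, fun v => pderiv_inclA_eq_zero _ _ (hlt v) _⟩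
    · rw [← kappaMap_resA]
      exact (map_ne_zero _).2 hb
    · rw [← kappaMap_resA, ← kappaMap_resA, hιmap, ← map_mul, hab]
  · intro g hg
    rw [resA_eq_zero]
    exact Ideal.subset_span ⟨g, hg, rfl⟩
  · intro a ha
    -- Δ is extended from A_{i+k}, so membership in it means membership in the span of the
    -- transforms after multiplying by some s outside p, which is a unit in B_{i+k}.
    rw [resA_eq_zero, hΔ, Delta_eq_map,
      IsLocalization.algebraMap_mem_map_algebraMap_iff (pA p (i + k)).primeCompl] at ha
    obtain ⟨s, hs, hsa⟩ := ha
    refine ⟨s, ?_, hsa⟩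
    exact ((IsLocalization.map_units (B p (i + k))
      (⟨s, hs⟩ : (pA p (i + k)).primeCompl)).map (toKappa Δ)).ne_zero

theorem HasPsi.hasTrdeg {σ : K →+* K} {f : Fin r → DPoly K n} {p : Ideal (DPoly K n)} [p.IsPrime]
    {m N : ℕ} {z : ℤ} (h : HasPsi σ f p m z) (hN : m + maxOrder f - 1 = N) :
    HasTrdeg K (Kappa (Delta σ f p m N)) z := by
  subst hN
  exact h

end

/-! ### Additivity in towers and the main theorem -/

theorem HasTrdeg.of_tower.{u, v} {K : Type u} {E L : Type v} [Field K] [Field E] [Field L]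
    [Algebra K E] [Algebra K L] {z y : ℤ} (φ : E →+* L)
    (hφ : ∀ c, φ (algebraMap K E c) = algebraMap K L c)
    (hKL : HasTrdeg K L z) (hEL : HasTrdegHom φ y) : HasTrdeg K E (z - y) := by
  let : Algebra E L := φ.toAlgebra
  have : IsScalarTower K E L := .of_algebraMap_eq fun c => (hφ c).symm
  obtain ⟨t, ht, rfl⟩ := hKL
  obtain ⟨t', ht', rfl⟩ := hEL
  have h := trdeg_add_eq K E (A := L)
  rw [ht, ht'] at h
  have hlt : Algebra.trdeg K E < Cardinal.aleph0 :=
    (self_le_add_right _ _).trans_lt (h ▸ Cardinal.natCast_lt_aleph0)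
  obtain ⟨t'', ht''⟩ := Cardinal.lt_aleph0.1 hlt
  rw [ht''] at h
  have h' : t'' + t' = t := by exact_mod_cast h
  exact ⟨t'', ht'', by omega⟩

end DiffSys

theorem mainTheorem7 {K : Type*} [Field K] [CharZero K] (σ : K →+* K) {n r : ℕ}
    (f : Fin r → DiffSys.DPoly K n) (he : 1 ≤ DiffSys.maxOrder f)
    (p : Ideal (DiffSys.DPoly K n)) [p.IsPrime]
    (hp : DiffSys.IsMinimalDiffPrime (DiffSys.shift σ) (Set.range f) p)
    (hq : DiffSys.IsQuasiPrime σ f p hp.prop.1)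
    (hrank : DiffSys.RankCondition σ f p)
    (k i : ℕ) (hi : DiffSys.maxOrder f ≤ i + 1) :
    haveI : (DiffSys.Delta σ f p (i + 1 - DiffSys.maxOrder f + k) (i + k)).IsPrime :=
      hq.isPrime (by omega)
    ∀ j : ℕ, DiffSys.maxOrder f ≤ j + 1 →
      DiffSys.HasTrdegHom
        (DiffSys.kappaMap (DiffSys.mapB p (Nat.le_add_right i k))
          (DiffSys.Delta σ f p (i + 1 - DiffSys.maxOrder f + k) (i + k)))
        ((k : ℤ) * ((n : ℤ) - r) + DiffSys.mu σ f p k j) ∧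
      ∀ (d : ℕ) (s : ℤ) (ρ : ℕ), DiffSys.IsQuasiDimPoly σ f p d s →
        DiffSys.IsQuasiRegularityDegree σ f p d s ρ →
        ρ + DiffSys.maxOrder f ≤ i + k + 1 →
        DiffSys.HasTrdeg K
          (DiffSys.Kappa ((DiffSys.Delta σ f p (i + 1 - DiffSys.maxOrder f + k) (i + k)).comap
            (DiffSys.mapB p (Nat.le_add_right i k))))
          ((d : ℤ) * ((i : ℤ) + 1) + ((d : ℤ) + r - n) * k + s - DiffSys.maxOrder f * d -
            DiffSys.mu σ f p k j) := by
  have hprime : (DiffSys.Delta σ f p (i + 1 - DiffSys.maxOrder f + k) (i + k)).IsPrime :=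
    hq.isPrime (by omega)
  intro j hj
  have h1 : DiffSys.HasTrdegHom
        (DiffSys.kappaMap (DiffSys.mapB p (Nat.le_add_right i k))
          (DiffSys.Delta σ f p (i + 1 - DiffSys.maxOrder f + k) (i + k)))
        ((k : ℤ) * ((n : ℤ) - r) + DiffSys.mu σ f p k j) := by
    have h := DiffSys.hasTrdegHom_kappaMap (k := k) σ f p hi
    -- The shift 0 in the rank condition gives κ(Δ_{i-e+1+k}) itself, the field in which the
    -- Jacobian criterion was applied.
    have hr := hrank k i hi 0
    have hmu := DiffSys.mu_add_rank σ f p k j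
    rw [DiffSys.rank_pseudoJacobianKappa_eq σ f hp.prop.1 k hj hi, ← hr] at hmu
    convert h using 1
    have hmu' := congrArg (Nat.cast : ℕ → ℤ) hmu
    push_cast at hmu'
    linear_combination hmu'
  refine ⟨h1, fun d s ρ _ hρ hle => ?_⟩
  -- The index m = i-e+1+k satisfies m ≥ ρ by the bound on i + k, and Δ_m lives in B_{m-1+e} =
  -- B_{i+k}; so ψ(m) = dm + s is the transcendence degree of the top field.
  have hψ := (hρ.1 (i + 1 - DiffSys.maxOrder f + k) (by omega)).hasTrdeg
    (show _ = i + k by omega)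
  have h2 := DiffSys.HasTrdeg.of_tower _ (fun c => ?_) hψ h1
  · refine (congrArg (DiffSys.HasTrdeg K _) ?_).mp h2
    push_cast [Nat.cast_sub hi]
    ring
  · rw [DiffSys.algebraMap_kappa, DiffSys.kappaMap_resA, DiffSys.algebraMap_kappa]
    simp [DiffSys.inclA]
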